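/- Let $X$ be a complex Banach space, let $0<\alpha<1$, and let $A:\mathcal D(A)\subset X\to X$ be a closed, densely defined linear operator with $0\in\rho(A)$ for which there is $\gamma\in(\pi/2,\pi)$ such that $\Sigma_\gamma:=\{z\in\mathbb C\setminus\{0\}:|\arg z|<\gamma\}\subset\rho(A)$ and such that for every $\varepsilon\in(0,\gamma)$ there is $C_\varepsilon>0$ with $\|(\lambda-A)^{-1}\|\le C_\varepsilon/|\lambda|$ for all $\lambda\in\Sigma_{\gamma-\varepsilon}$. For $1\le q\le\infty$ and $T>0$ let $J^\alpha f(t)=\frac1{\Gamma(\alpha)}\int_0^t(t-s)^{\alpha-1}f(s)\,ds$ for $f\in L^q(0,T;X)$; put $W_{\alpha,q}(0,T;X)=J^\alpha L^q(0,T;X)$ and $\partial_t^\alpha=(J^\alpha)^{-1}:W_{\alpha,q}(0,T;X)\to L^q(0,T;X)$. For $a\in X$, a function $u:(0,\infty)\to X$ is called a solution of $$\partial_t^\alpha(u-a)=Au,\qquad t>0,$$ if for every $T>0$ one has $u\in L^q(0,T;\mathcal D(A))$ (graph norm on $\mathcal D(A)$), $u-a\in W_{\alpha,q}(0,T;X)$,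 and the equation holds in $L^q(0,T;X)$. Then there is a constant $C>0$, depending only on $A$ and $\alpha$, such that for all $1\le q\le\infty$, all $\mu$ with $1-\frac1{q\alpha}<\mu<1$ (where $\frac1\infty=0$), all $a\in\mathcal D((-A)^\mu)$ and every solution $u$, the function $u$ coincides almost everywhere on $(0,\infty)$ with a function that is continuous on $(0,\infty)$, and this continuous representative, again denoted by $u$, satisfies $$\|u(t)\|\le C\,t^{-\alpha}\|a\|\qquad\text{for all } t>0.$$ -/

import Mathlib

open MeasureTheory Set
open scoped ENNReal

namespace TimeFractional

noncomputable section

/-- `R` is a bounded two-sided inverse `(z - A)⁻¹` of `z - A : D(A) → X`. -/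
def IsResolventAt {X : Type*} [NormedAddCommGroup X] [NormedSpace ℂ X]
    (A : X →ₗ.[ℂ] X) (z : ℂ) (R : X →L[ℂ] X) : Prop :=
  (∀ x : X, ∃ h : R x ∈ A.domain, z • R x - A ⟨R x, h⟩ = x) ∧
  (∀ x : A.domain, R (z • (x : X) - A x) = x)

/-- The resolvent set `ρ(A)` of an unbounded operator. -/
def resolventSet {X : Type*} [NormedAddCommGroup X] [NormedSpace ℂ X]
    (A : X →ₗ.[ℂ] X) : Set ℂ :=
  {z | ∃ R : X →L[ℂ] X, IsResolventAt A z R}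

open Classical in
/-- The resolvent `(z - A)⁻¹` for `z ∈ ρ(A)` (and `0` for `z ∉ ρ(A)`). -/
def resolvent {X : Type*} [NormedAddCommGroup X] [NormedSpace ℂ X]
    (A : X →ₗ.[ℂ] X) (z : ℂ) : X →L[ℂ] X :=
  if h : z ∈ resolventSet A then h.choose else 0

/-- The open sector `Σ_γ = {z ≠ 0 : |arg z| < γ}`. -/
def sector (γ : ℝ) : Set ℂ := {z | z ≠ 0 ∧ |z.arg| < γ}

/-- Condition (𝒜): `A` is closed and densely defined, its resolvent set contains a sector
`Σ_γ` with `π/2 < γ < π`, `‖(z - A)⁻¹‖ ≤ C_ε / |z|` on each smaller sector `Σ_{γ-ε}`,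
and `0 ∈ ρ(A)`. -/
structure ConditionA {X : Type*} [NormedAddCommGroup X] [NormedSpace ℂ X]
    (A : X →ₗ.[ℂ] X) : Prop where
  closed : A.IsClosed
  dense : Dense (A.domain : Set X)
  sectorial : ∃ γ ∈ Ioo (Real.pi / 2) Real.pi, sector γ ⊆ resolventSet A ∧
    ∀ ε ∈ Ioo 0 γ, ∃ C : ℝ, 0 < C ∧
      ∀ z ∈ sector (γ - ε), ‖resolvent A z‖ ≤ C / ‖z‖
  zero_mem : (0 : ℂ) ∈ resolventSet A

/-- The negative fractional power, for `0 < μ < 1`,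
`(-A)^{-μ} x = (sin πμ / π) ∫₀^∞ s^{-μ} (s - A)⁻¹ x ds`. -/
def negFracPow {X : Type*} [NormedAddCommGroup X] [NormedSpace ℂ X]
    (A : X →ₗ.[ℂ] X) (μ : ℝ) (x : X) : X :=
  (Real.sin (Real.pi * μ) / Real.pi) •
    ∫ s in Ioi (0 : ℝ), s ^ (-μ) • resolvent A (s : ℂ) x

/-- The domain `D((-A)^μ)` of the fractional power, for `μ < 1`. For `0 < μ < 1` the operator
`(-A)^μ` is the inverse of `(-A)^{-μ}`, so its domain is the range of `(-A)^{-μ}`;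
for `μ ≤ 0` the operator `(-A)^μ` is bounded and everywhere defined. -/
def fracDomain {X : Type*} [NormedAddCommGroup X] [NormedSpace ℂ X]
    (A : X →ₗ.[ℂ] X) (μ : ℝ) : Set X :=
  {a | 0 < μ → a ∈ range (negFracPow A μ)}

/-- The fractional integral `J^β v (t) = Γ(β)⁻¹ ∫₀ᵗ (t - s)^{β-1} v(s) ds`. -/
def fracIntegral {X : Type*} [NormedAddCommGroup X] [NormedSpace ℂ X]
    (β : ℝ) (v : ℝ → X) (t : ℝ) : X :=
  (Real.Gamma β)⁻¹ • ∫ s in (0 : ℝ)..t, (t - s) ^ (β - 1) • v s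

/-- `v ∈ W_{β,q}(0,T;X) = J^β L^q(0,T;X)` and `∂_t^β v = (J^β)⁻¹ v = f`. -/
def HasFracDeriv {X : Type*} [NormedAddCommGroup X] [NormedSpace ℂ X]
    (β : ℝ) (q : ℝ≥0∞) (T : ℝ) (v f : ℝ → X) : Prop :=
  MemLp f q (volume.restrict (Ioo 0 T)) ∧
    v =ᵐ[volume.restrict (Ioo 0 T)] fracIntegral β f

/-- `u ∈ L^q(0,T;D(A))`, for the graph norm on `D(A)`, and `A u = w` almost everywhere. -/
def MemLpDomain {X : Type*} [NormedAddCommGroup X] [NormedSpace ℂ X]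
    (A : X →ₗ.[ℂ] X) (q : ℝ≥0∞) (T : ℝ) (u w : ℝ → X) : Prop :=
  MemLp u q (volume.restrict (Ioo 0 T)) ∧ MemLp w q (volume.restrict (Ioo 0 T)) ∧
    ∀ᵐ t ∂(volume.restrict (Ioo 0 T)), ∃ h : u t ∈ A.domain, A ⟨u t, h⟩ = w t

/-- `u` is a strong solution of `∂_t^α (u - a) = A u` on `(0,T)`: `u ∈ L^q(0,T;D(A))`,
`u - a ∈ W_{α,q}(0,T;X)`, and the equation holds in `L^q(0,T;X)`. -/
def IsStrongSolution {X : Type*} [NormedAddCommGroup X] [NormedSpace ℂ X]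
    (A : X →ₗ.[ℂ] X) (α : ℝ) (q : ℝ≥0∞) (T : ℝ) (a : X) (u : ℝ → X) : Prop :=
  ∃ w : ℝ → X, MemLpDomain A q T u w ∧ HasFracDeriv α q T (fun t => u t - a) w

end

end TimeFractional

/-!
The solution is identified with `v t = S(t) a`, where `S(t)` is the inverse Laplace transform of
`λ ↦ λ^{α-1} (λ^α - A)⁻¹` along the rays `|arg λ| = γ`, `π / 2 < γ < π`. Since `α < 1`, the
points `λ^α` stay in a strictly smaller sector, where `‖(z - A)⁻¹‖ ≤ C / |z|`; since `0 ∈ ρ(A)`,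
the resolvent is also bounded there, so the integrand is at most `M e^{-c t |λ|} |λ|^{α-1}`. The
substitution `λ ↦ λ / t` then gives the decay `t^{-α}` at once (`norm_sectorInverse_le`). All
contour integrals are written in the coordinate `log λ`, in which sectors are horizontal strips and
Cauchy's theorem for rectangles suffices (`integral_strip_sub_eq`). Cauchy's formula shows that the
Laplace transform of `S(t) a` at `p > 0` is `p^{α-1} (p^α - A)⁻¹ a` (`laplace_sectorInverse`).

A strong solution has no growth restriction at infinity, so it has no Laplace transform to compare
with. It is cut off at a time `T` instead. Applying `(p^α - A)⁻¹` to the truncated equation shows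
that the Laplace transform of the cut-off solution is `p^{α-1} (p^α - A)⁻¹ a + O(e^{-pT})`
(`IsStrongSolution.exists_laplace_bound`), and a function whose Laplace transform is `O(e^{-pT})`
vanishes on `(0, T)` (`ae_eq_zero_of_laplace_decay`). Hence `u = S(·) a` almost everywhere.

The argument runs in `L¹(0, T) ⊇ L^q(0, T)`, which is why the constant is uniform in `q`.
-/

namespace TimeFractional

open Filter Topology

/-! ### Uniqueness for the Laplace transform -/

/-- A locally integrable function whose primitive vanishes on `(0, T)` vanishes there. -/
theorem ae_eq_zero_of_setIntegral_Ioc_eq_zero {E : Type*} [NormedAddCommGroup E] [NormedSpace ℝ E]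
    [CompleteSpace E] {v : ℝ → E} {T : ℝ} (hv : IntegrableOn v (Ioo 0 T))
    (h : ∀ t ∈ Ioo 0 T, ∫ s in Ioc 0 t, v s = 0) : v =ᵐ[volume.restrict (Ioo 0 T)] 0 := by
  have hloc : LocallyIntegrable ((Ioo 0 T).indicator v) volume :=
    ((integrable_indicator_iff measurableSet_Ioo).2 hv).locallyIntegrable
  rw [EventuallyEq, ae_restrict_iff' measurableSet_Ioo]
  filter_upwards [LocallyIntegrable.ae_hasDerivAt_integral hloc] with t ht htT
  have h0 : HasDerivAt (fun x => ∫ s in (0 : ℝ)..x, (Ioo 0 T).indicator v s) 0 t := by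
    refine (hasDerivAt_const t (0 : E)).congr_of_eventuallyEq ?_
    filter_upwards [isOpen_Ioo.mem_nhds htT] with x hx
    rw [intervalIntegral.integral_of_le hx.1.le, ← h x hx]
    refine setIntegral_congr_fun measurableSet_Ioc fun s hs => ?_
    exact indicator_of_mem (show s ∈ Ioo 0 T from ⟨hs.1, hs.2.trans_lt hx.2⟩) v
  simpa [indicator_of_mem htT] using (ht 0).unique h0

theorem hasSum_one_sub_exp_neg (y : ℝ) :
    HasSum (fun k : ℕ => (-1) ^ k / ((k + 1).factorial : ℝ) * y ^ (k + 1))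
      (1 - Real.exp (-y)) := by
  have h := NormedSpace.expSeries_div_hasSum_exp (-y)
  rw [← Real.exp_eq_exp_ℝ] at h
  have h' := ((hasSum_nat_add_iff' 1).2 h).neg
  simp only [Finset.range_one, Finset.sum_singleton, pow_zero, Nat.factorial_zero, Nat.cast_one,
    div_one, neg_sub] at h'
  refine h'.congr_fun fun k => ?_
  rw [neg_pow y (k + 1), pow_succ (-1 : ℝ)]
  ring

theorem abs_one_sub_exp_neg_exp_le {n τ : ℝ} (hn : 1 ≤ n) :
    |1 - Real.exp (-Real.exp (n * τ))| ≤ Real.exp τ := by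
  have h1 : Real.exp (-Real.exp (n * τ)) ≤ 1 := by
    rw [Real.exp_le_one_iff]; linarith [Real.exp_pos (n * τ)]
  rw [abs_of_nonneg (by linarith)]
  rcases le_total 0 τ with h | h
  · linarith [Real.exp_pos (-Real.exp (n * τ)), Real.one_le_exp h]
  · have h2 := Real.add_one_le_exp (-Real.exp (n * τ))
    have h3 : Real.exp (n * τ) ≤ Real.exp τ := Real.exp_le_exp.2 (by nlinarith)
    linarith

theorem tendsto_one_sub_exp_neg_exp {τ : ℝ} (hτ : τ ≠ 0) :
    Tendsto (fun n : ℕ => 1 - Real.exp (-Real.exp (((n : ℝ) + 1) * τ))) atTop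
      (𝓝 (if 0 < τ then 1 else 0)) := by
  have hn : Tendsto (fun n : ℕ => (n : ℝ) + 1) atTop atTop :=
    tendsto_atTop_add_const_right _ _ tendsto_natCast_atTop_atTop
  split_ifs with h
  · have := (Real.tendsto_exp_neg_atTop_nhds_zero.comp
      (Real.tendsto_exp_atTop.comp (hn.atTop_mul_const h))).const_sub 1
    simpa [Function.comp_def] using this
  · have h' : τ < 0 := lt_of_le_of_ne (not_lt.1 h) hτ
    have := ((Real.continuous_exp.tendsto _).comp
      (Real.tendsto_exp_atBot.comp (hn.atTop_mul_const_of_neg h')).neg).const_sub 1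
    simpa [Function.comp_def] using this

/-- **Quantitative uniqueness for the Laplace transform.** Testing with the kernels
`1 - exp (-e^{n (t - s)})`, which are power series in `e^{-n s}` and converge to the indicator
function of `s < t`, shows that the primitive of `v` vanishes on `(0, T)`. -/
theorem ae_eq_zero_of_laplace_decay {E : Type*} [NormedAddCommGroup E] [NormedSpace ℝ E]
    [CompleteSpace E] {v : ℝ → E} {T K : ℝ}
    (hv : IntegrableOn (fun t => Real.exp (-t) • v t) (Ioi 0))
    (h : ∀ p : ℝ, 1 ≤ p →
      ‖∫ t in Ioi (0 : ℝ), Real.exp (-(p * t)) • v t‖ ≤ K * Real.exp (-(p * T))) :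
    v =ᵐ[volume.restrict (Ioo 0 T)] 0 := by
  have hmeas : AEStronglyMeasurable v (volume.restrict (Ioi 0)) := by
    have := (Real.continuous_exp.aestronglyMeasurable (μ := volume.restrict (Ioi (0 : ℝ)))).smul
      hv.aestronglyMeasurable
    refine this.congr (Eventually.of_forall fun t => ?_)
    simp [smul_smul, ← Real.exp_add]
  have hvT : IntegrableOn v (Ioo 0 T) := by
    refine ((hv.mono_set Ioo_subset_Ioi_self).norm.const_mul (Real.exp T)).mono'
      (hmeas.mono_measure (Measure.restrict_mono Ioo_subset_Ioi_self le_rfl)) ?_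
    filter_upwards [ae_restrict_mem measurableSet_Ioo] with t ht
    rw [norm_smul, Real.norm_of_nonneg (Real.exp_pos _).le, ← mul_assoc, ← Real.exp_add]
    exact le_mul_of_one_le_left (norm_nonneg _) (Real.one_le_exp (by linarith [ht.2]))
  refine ae_eq_zero_of_setIntegral_Ioc_eq_zero hvT fun t ht => ?_
  have hexp : ∀ {p : ℝ}, 1 ≤ p → ∀ s ∈ Ioi (0 : ℝ), Real.exp (-(p * s)) * ‖v s‖ ≤
      ‖Real.exp (-s) • v s‖ := by
    intro p hp s hs
    rw [norm_smul, Real.norm_of_nonneg (Real.exp_pos _).le]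
    have : 0 < s := hs
    gcongr
    nlinarith
  have hint : ∀ {p : ℝ}, 1 ≤ p →
      IntegrableOn (fun s => Real.exp (-(p * s)) • v s) (Ioi 0) := by
    intro p hp
    refine hv.norm.mono' ((Continuous.aestronglyMeasurable (by fun_prop)).smul hmeas) ?_
    filter_upwards [ae_restrict_mem measurableSet_Ioi] with s hs
    rw [norm_smul, Real.norm_of_nonneg (Real.exp_pos _).le]
    exact hexp hp s hs
  set I : ℕ → E := fun n =>
    ∫ s in Ioi (0 : ℝ), (1 - Real.exp (-Real.exp (((n : ℝ) + 1) * (t - s)))) • v s with hI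
  have hK : 0 ≤ K := by
    have := (norm_nonneg _).trans (h 1 le_rfl)
    exact nonneg_of_mul_nonneg_left this (Real.exp_pos _)
  have hbound : ∀ n : ℕ, ‖I n‖ ≤
      K * (Real.exp (Real.exp (((n : ℝ) + 1) * (t - T))) - 1) := by
    intro n
    set m : ℝ := (n : ℝ) + 1
    have hm : 1 ≤ m := by simp [m]
    set c : ℕ → ℝ := fun k => (-1) ^ k / ((k + 1).factorial : ℝ) * Real.exp (m * (k + 1) * t)
    have hc : ∀ k, |c k| = Real.exp (m * t) ^ (k + 1) / ((k + 1).factorial : ℝ) := by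
      intro k
      rw [abs_mul, abs_div, abs_pow, abs_neg, abs_one, one_pow, abs_of_pos (Real.exp_pos _),
        Nat.abs_cast, ← Real.exp_nat_mul]
      push_cast
      ring_nf
    have hmk : ∀ k : ℕ, 1 ≤ m * (k + 1) := fun k => by
      have : (0 : ℝ) ≤ k := k.cast_nonneg
      nlinarith
    have hsum : ∀ y : ℝ, HasSum (fun k : ℕ => y ^ (k + 1) / ((k + 1).factorial : ℝ))
        (Real.exp y - 1) := fun y => by
      have h := NormedSpace.expSeries_div_hasSum_exp y
      rw [← Real.exp_eq_exp_ℝ] at h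
      simpa using (hasSum_nat_add_iff' 1).2 h
    have hF : ∀ k, Integrable (fun s => c k • Real.exp (-(m * (k + 1) * s)) • v s)
        (volume.restrict (Ioi 0)) := fun k => (hint (hmk k)).smul (c k)
    have hS := hasSum_integral_of_summable_integral_norm hF (by
      refine Summable.of_nonneg_of_le (fun k => integral_nonneg fun _ => norm_nonneg _) (fun k => ?_)
        ((hsum (Real.exp (m * t))).summable.mul_right
          (∫ s in Ioi (0 : ℝ), ‖Real.exp (-s) • v s‖))
      rw [← hc, ← integral_const_mul]
      refine setIntegral_mono_on (hF k).norm (hv.norm.const_mul _) measurableSet_Ioi fun s hs => ?_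
      rw [norm_smul, norm_smul (Real.exp _), Real.norm_of_nonneg (Real.exp_pos _).le,
        Real.norm_eq_abs]
      exact mul_le_mul_of_nonneg_left (hexp (hmk k) s hs) (abs_nonneg _))
    -- The series in `e^{-m s}` is integrated term by term.
    have hIn : (∫ s in Ioi (0 : ℝ), ∑' k, c k • Real.exp (-(m * (k + 1) * s)) • v s) = I n := by
      refine integral_congr_ae (Eventually.of_forall fun s => ?_)
      refine HasSum.tsum_eq (((hasSum_one_sub_exp_neg (Real.exp (m * (t - s)))).smul_const
        (v s)).congr_fun ?_)
      intro k
      rw [smul_smul, mul_assoc, ← Real.exp_add, ← Real.exp_nat_mul]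
      push_cast
      ring_nf
    rw [hIn] at hS
    refine hS.norm_le_of_bounded (((hsum _).mul_left K)) fun k => ?_
    rw [integral_smul, norm_smul, Real.norm_eq_abs, hc]
    refine (mul_le_mul_of_nonneg_left (h _ (hmk k)) (by positivity)).trans (le_of_eq ?_)
    rw [← Real.exp_nat_mul, ← Real.exp_nat_mul, div_mul_eq_mul_div, mul_left_comm,
      ← Real.exp_add, mul_div_assoc]
    push_cast
    ring_nf
  -- `e^{n (t - T)} → 0` because `t < T`.
  have hlim0 : Tendsto I atTop (𝓝 0) := by
    refine squeeze_zero_norm hbound ?_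
    have hn : Tendsto (fun n : ℕ => (n : ℝ) + 1) atTop atTop :=
      tendsto_atTop_add_const_right _ _ tendsto_natCast_atTop_atTop
    have := (((Real.continuous_exp.tendsto _).comp (Real.tendsto_exp_atBot.comp
      (hn.atTop_mul_const_of_neg (sub_neg.2 ht.2)))).sub_const 1).const_mul K
    simpa [Function.comp_def] using this
  have hlim : Tendsto I atTop
      (𝓝 (∫ s in Ioi (0 : ℝ), (if 0 < t - s then (1 : ℝ) else 0) • v s)) := by
    refine tendsto_integral_of_dominated_convergence
      (fun s => Real.exp t * ‖Real.exp (-s) • v s‖)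
      (fun n => (Continuous.aestronglyMeasurable (by fun_prop)).smul hmeas)
      (hv.norm.const_mul _) (fun n => ?_) ?_
    · refine Eventually.of_forall fun s => ?_
      rw [norm_smul, norm_smul, Real.norm_of_nonneg (Real.exp_pos _).le, ← mul_assoc,
        ← Real.exp_add, Real.norm_eq_abs, ← sub_eq_add_neg]
      exact mul_le_mul_of_nonneg_right (abs_one_sub_exp_neg_exp_le (by simp)) (norm_nonneg _)
    · filter_upwards [ae_restrict_of_ae (Measure.ae_ne volume t)] with s hs
      exact (tendsto_one_sub_exp_neg_exp (sub_ne_zero.2 hs.symm)).smul_const _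
  rw [← tendsto_nhds_unique hlim hlim0, ← integral_Ioc_eq_integral_Ioo.symm,
    ← Ioi_inter_Iio, ← setIntegral_indicator measurableSet_Iio]
  refine integral_congr_ae (Eventually.of_forall fun s => ?_)
  by_cases hs : s < t <;> simp [hs, sub_pos]

/-! ### Cauchy's integral formula in a strip -/

section ContourIntegrals

open Complex

theorem strip_eq_reProdIm_subset {b c L : ℝ} (hbc : b < c) (hb : 0 < b) :
    (uIcc (-L) L ×ℂ uIcc (-b) b) ⊆ {z : ℂ | |z.im| < c} := by
  intro z hz
  have h := hz.2
  rw [mem_preimage, uIcc_of_le (by linarith)] at h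
  exact (abs_le.2 h).trans_lt hbc

theorem integral_inv_sq_add_sq {b : ℝ} (hb : 0 < b) (x₀ : ℝ) :
    Integrable (fun x : ℝ => 2 * b / ((x - x₀) ^ 2 + b ^ 2)) ∧
      ∫ x : ℝ, 2 * b / ((x - x₀) ^ 2 + b ^ 2) = 2 * Real.pi := by
  have h : (fun x : ℝ => 2 * b / ((x - x₀) ^ 2 + b ^ 2)) =
      fun x => (fun y => (2 / b) * (1 + (y / b) ^ 2)⁻¹) (x - x₀) := by
    funext x
    field_simp
    ring
  rw [h]
  refine ⟨((integrable_inv_one_add_sq.comp_div hb.ne').const_mul (2 / b)).comp_sub_right x₀, ?_⟩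
  rw [integral_sub_right_eq_self (fun y => (2 / b) * (1 + (y / b) ^ 2)⁻¹) x₀, integral_const_mul,
    Measure.integral_comp_div (fun y => (1 + y ^ 2)⁻¹) b, integral_univ_inv_one_add_sq,
    abs_of_pos hb, smul_eq_mul]
  field_simp

/-- **Cauchy's integral formula for a horizontal strip**, for a function with one simple pole at a
real point. The pole is removed by passing to `dslope`; its contribution is an arctangent
integral. -/
theorem integral_strip_sub_eq {E : Type*} [NormedAddCommGroup E] [NormedSpace ℂ E]
    [CompleteSpace E] {Θ Ψ : ℂ → E} {b c x₀ : ℝ} {g : ℝ → ℝ} (hb : 0 < b) (hbc : b < c)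
    (hΘ : DifferentiableOn ℂ Θ {z | |z.im| < c})
    (hΨ : ∀ z : ℂ, |z.im| < c → z ≠ x₀ → Ψ z = (z - x₀)⁻¹ • Θ z)
    (hg : Tendsto g atTop (𝓝 0))
    (hdecay : ∀ᶠ L : ℝ in atTop, ∀ y : ℝ, |y| ≤ b →
      ‖Ψ (L + y * I)‖ ≤ g L ∧ ‖Ψ ((-L : ℝ) + y * I)‖ ≤ g L)
    (hup : Integrable fun x : ℝ => Ψ (x + b * I))
    (hlow : Integrable fun x : ℝ => Ψ (x + (-b : ℝ) * I)) :
    (∫ x : ℝ, Ψ (x + b * I)) - ∫ x : ℝ, Ψ (x + (-b : ℝ) * I) =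
      -(2 * Real.pi * I) • Θ x₀ := by
  have hopen : IsOpen {z : ℂ | |z.im| < c} :=
    isOpen_lt (continuous_abs.comp continuous_im) continuous_const
  have hD : DifferentiableOn ℂ (dslope Θ x₀) {z | |z.im| < c} :=
    (differentiableOn_dslope (hopen.mem_nhds (by simpa using hb.trans hbc))).2 hΘ
  have hDval : ∀ z : ℂ, |z.im| < c → z ≠ x₀ →
      dslope Θ x₀ z = Ψ z - (z - x₀)⁻¹ • Θ x₀ := by
    intro z hz hne
    rw [dslope_of_ne _ hne, slope_def_module, smul_sub, hΨ z hz hne]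
  obtain ⟨hint, hval⟩ := integral_inv_sq_add_sq hb x₀
  have hintC : Integrable fun x : ℝ => (((2 * b / ((x - x₀) ^ 2 + b ^ 2) : ℝ) : ℂ) * I) • Θ x₀ :=
    (hint.ofReal.mul_const I).smul_const _
  -- the horizontal sides
  have hhor : ∀ x : ℝ, dslope Θ x₀ (x + (-b : ℝ) * I) - dslope Θ x₀ (x + b * I) =
      Ψ (x + (-b : ℝ) * I) - Ψ (x + b * I) -
        (((2 * b / ((x - x₀) ^ 2 + b ^ 2) : ℝ) : ℂ) * I) • Θ x₀ := by
    intro x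
    have him : ∀ y : ℝ, ((x : ℂ) + y * I).im = y := fun y => by simp
    have hne : ∀ y : ℝ, y ≠ 0 → (x : ℂ) + y * I ≠ x₀ := fun y hy h => by
      have := congrArg Complex.im h
      rw [him] at this
      exact hy (by simpa using this)
    rw [hDval _ (by rw [him, abs_neg, abs_of_pos hb]; exact hbc) (hne _ (neg_ne_zero.2 hb.ne')),
      hDval _ (by rw [him, abs_of_pos hb]; exact hbc) (hne _ hb.ne')]
    have h1 : (x : ℂ) + (-b : ℝ) * I - x₀ ≠ 0 := sub_ne_zero.2 (hne _ (neg_ne_zero.2 hb.ne'))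
    have h2 : (x : ℂ) + b * I - x₀ ≠ 0 := sub_ne_zero.2 (hne _ hb.ne')
    have h3 : ((x : ℂ) + (-b : ℝ) * I - x₀) * (x + b * I - x₀) = (x - x₀) ^ 2 + b ^ 2 := by
      push_cast
      linear_combination (-(b : ℂ) ^ 2) * I_sq
    have h4 : ((x : ℂ) + (-b : ℝ) * I - x₀)⁻¹ - (x + b * I - x₀)⁻¹ =
        ((2 * b / ((x - x₀) ^ 2 + b ^ 2) : ℝ) : ℂ) * I := by
      rw [inv_sub_inv h1 h2, h3]
      push_cast
      ring
    rw [← h4, sub_smul]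
    abel
  have hhorlim : Tendsto (fun L : ℝ => (∫ x in -L..L, dslope Θ x₀ (x + (-b : ℝ) * I)) -
      ∫ x in -L..L, dslope Θ x₀ (x + b * I)) atTop
      (𝓝 ((∫ x : ℝ, Ψ (x + (-b : ℝ) * I)) - (∫ x : ℝ, Ψ (x + b * I)) -
        (2 * Real.pi * I) • Θ x₀)) := by
    have hlim := intervalIntegral_tendsto_integral ((hlow.sub hup).sub hintC) tendsto_neg_atTop_atBot
      tendsto_id
    have hval' : ∫ x : ℝ, (((2 * b / ((x - x₀) ^ 2 + b ^ 2) : ℝ) : ℂ) * I) • Θ x₀ =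
        (2 * Real.pi * I) • Θ x₀ := by
      rw [integral_smul_const, integral_mul_const, integral_complex_ofReal, hval]
      push_cast
      rfl
    rw [integral_sub' (hlow.sub hup) hintC, integral_sub' hlow hup, hval'] at hlim
    refine hlim.congr fun L => ?_
    have hii : ∀ y : ℝ, |y| < c →
        IntervalIntegrable (fun x : ℝ => dslope Θ x₀ (x + y * I)) volume (-L) L := fun y hy =>
      (hD.continuousOn.comp_continuous (by fun_prop) fun x => by simpa using hy).intervalIntegrable
        _ _
    rw [← intervalIntegral.integral_sub (hii (-b) (by rwa [abs_neg, abs_of_pos hb]))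
      (hii b (by rwa [abs_of_pos hb]))]
    refine intervalIntegral.integral_congr fun x _ => ?_
    simp only [Pi.sub_apply]
    exact (hhor x).symm
  -- the vertical sides
  have hver : ∀ s : ℝ → ℝ, Tendsto (fun L => |s L|) atTop atTop →
      (∀ᶠ L in atTop, ∀ y : ℝ, |y| ≤ b → ‖Ψ (s L + y * I)‖ ≤ g L) →
      Tendsto (fun L => I • ∫ y in -b..b, dslope Θ x₀ (s L + y * I)) atTop (𝓝 0) := by
    intro s hs hdec
    have hinv : Tendsto (fun L => (g L + (|s L| - |x₀|)⁻¹ * ‖Θ x₀‖) * |b - -b|) atTop (𝓝 0) := by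
      have h1 : Tendsto (fun L => |s L| - |x₀|) atTop atTop :=
        tendsto_atTop_add_const_right _ (-|x₀|) hs
      simpa using (hg.add (h1.inv_tendsto_atTop.mul_const ‖Θ x₀‖)).mul_const |b - -b|
    refine squeeze_zero_norm' ?_ hinv
    filter_upwards [hdec, hs.eventually_gt_atTop |x₀|] with L hL hL'
    rw [norm_smul, norm_I, one_mul]
    refine intervalIntegral.norm_integral_le_of_norm_le_const fun y hy => ?_
    have hy' : |y| ≤ b := by
      rw [uIoc_of_le (by linarith)] at hy
      exact abs_le.2 ⟨hy.1.le, hy.2⟩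
    have hre : ((s L : ℂ) + y * I - x₀).re = s L - x₀ := by simp
    have hpos : |s L| - |x₀| ≤ ‖(s L : ℂ) + y * I - x₀‖ :=
      (abs_sub_abs_le_abs_sub _ _).trans (hre ▸ abs_re_le_norm _)
    rw [hDval _ (by simpa using hy'.trans_lt hbc)
      (fun h => by rw [h, sub_self, norm_zero] at hpos; linarith)]
    refine (norm_sub_le _ _).trans (add_le_add (hL y hy') ?_)
    rw [norm_smul, norm_inv]
    gcongr
  have hright := hver id (tendsto_abs_atTop_atTop) (hdecay.mono fun L hL y hy => (hL y hy).1)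
  have hleft := hver (fun L => -L) (by simpa using tendsto_abs_atTop_atTop)
    (hdecay.mono fun L hL y hy => (hL y hy).2)
  have htot := (hhorlim.add hright).sub hleft
  have hzero := tendsto_nhds_unique htot (tendsto_const_nhds.congr fun L => by
    have := integral_boundary_rect_eq_zero_of_differentiableOn (dslope Θ x₀)
      (⟨-L, -b⟩ : ℂ) ⟨L, b⟩ (hD.mono (strip_eq_reProdIm_subset hbc hb))
    simpa using this.symm)
  rw [add_zero, sub_zero, sub_sub, sub_eq_zero] at hzero
  rw [hzero, neg_smul]
  abel

/-! ### Inverse Laplace transforms along the boundary of a sector -/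

theorem integrable_exp_mul_div {α p c : ℝ} (hα0 : 0 < α) (hα1 : α < 1) (hp : 0 < p) (hc : 0 < c) :
    Integrable fun x : ℝ => Real.exp (α * x) / (p + c * Real.exp x) := by
  have hpos : ∀ x, 0 < p + c * Real.exp x := fun x => by positivity
  have hmeas : AEStronglyMeasurable (fun x : ℝ => Real.exp (α * x) / (p + c * Real.exp x)) :=
    (Continuous.div (by fun_prop) (by fun_prop) fun x => (hpos x).ne').aestronglyMeasurable
  rw [← integrableOn_univ, ← Iic_union_Ioi (a := (0 : ℝ))]
  refine IntegrableOn.union ?_ ?_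
  · refine ((integrableOn_exp_mul_Iic hα0 0).div_const p).mono' hmeas.restrict
      (Eventually.of_forall fun x => ?_)
    rw [Real.norm_of_nonneg (by positivity)]
    gcongr
    exact le_add_of_nonneg_right (by positivity)
  · refine ((integrableOn_exp_mul_Ioi (sub_neg.2 hα1) 0).div_const c).mono' hmeas.restrict
      (Eventually.of_forall fun x => ?_)
    rw [Real.norm_of_nonneg (by positivity), sub_mul, one_mul, Real.exp_sub, div_div]
    gcongr
    rw [mul_comm]
    exact le_add_of_nonneg_left hp.le

theorem integrable_exp_mul_exp_neg_exp {α c : ℝ} (hα0 : 0 < α) (hα1 : α < 1) (hc : 0 < c) :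
    Integrable fun x : ℝ => Real.exp (α * x) * Real.exp (-(c * Real.exp x)) := by
  refine (integrable_exp_mul_div hα0 hα1 one_pos hc).mono'
    (Continuous.aestronglyMeasurable (by fun_prop)) (Eventually.of_forall fun x => ?_)
  rw [Real.norm_of_nonneg (by positivity), Real.exp_neg, ← div_eq_mul_inv]
  gcongr
  rw [add_comm]
  exact Real.add_one_le_exp _

variable {E : Type*} [NormedAddCommGroup E] [NormedSpace ℂ E]

/-- The integral of `e^{λ t} Φ (log λ) dλ / λ` along the ray `arg λ = θ`, written in the
coordinate `x = log |λ|`, so that the ray becomes the horizontal line `Im z = θ`. -/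
noncomputable def rayIntegral (θ : ℝ) (Φ : ℂ → E) (t : ℝ) : E :=
  ∫ x : ℝ, exp (t * exp (x + θ * I)) • Φ (x + θ * I)

theorem exp_add_mul_I_re (x θ : ℝ) : (exp (x + θ * I)).re = Real.exp x * Real.cos θ := by
  simp [exp_re]

theorem norm_exp_mul_exp (t x θ : ℝ) :
    ‖exp (t * exp (x + θ * I))‖ = Real.exp (-(t * -Real.cos θ * Real.exp x)) := by
  rw [norm_exp, re_ofReal_mul, exp_add_mul_I_re]
  ring_nf

section Ray

variable {α θ M : ℝ} {Φ : ℂ → E}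

theorem norm_ray_integrand_le (hM : ∀ x : ℝ, ‖Φ (x + θ * I)‖ ≤ M * Real.exp (α * x)) (t x : ℝ) :
    ‖exp (t * exp (x + θ * I)) • Φ (x + θ * I)‖ ≤
      M * (Real.exp (α * x) * Real.exp (-(t * -Real.cos θ * Real.exp x))) := by
  rw [norm_smul, norm_exp_mul_exp, mul_comm, ← mul_assoc]
  exact mul_le_mul_of_nonneg_right (hM x) (Real.exp_pos _).le

theorem continuous_ray_integrand (hΦ : Continuous fun x : ℝ => Φ (x + θ * I)) (t : ℝ) :
    Continuous fun x : ℝ => exp (t * exp (x + θ * I)) • Φ (x + θ * I) :=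
  Continuous.smul (by fun_prop) hΦ

/-- The substitution `λ ↦ λ / t` gives the decay rate `t ^ (-α)`. -/
theorem norm_rayIntegral_le (hα0 : 0 < α) (hα1 : α < 1) (hθ : Real.cos θ < 0)
    (hM : ∀ x : ℝ, ‖Φ (x + θ * I)‖ ≤ M * Real.exp (α * x)) {t : ℝ} (ht : 0 < t) :
    ‖rayIntegral θ Φ t‖ ≤
      M * t ^ (-α) * ∫ x : ℝ, Real.exp (α * x) * Real.exp (-(-Real.cos θ * Real.exp x)) := by
  have hsub : ∀ x : ℝ, M * (Real.exp (α * x) * Real.exp (-(t * -Real.cos θ * Real.exp x))) =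
      (fun y => M * t ^ (-α) * (Real.exp (α * y) * Real.exp (-(-Real.cos θ * Real.exp y))))
        (x + Real.log t) := by
    intro x
    simp only [mul_add, Real.exp_add, Real.exp_log ht]
    rw [mul_comm α (Real.log t), ← Real.rpow_def_of_pos ht, Real.rpow_neg ht.le]
    have := (Real.rpow_pos_of_pos ht α).ne'
    field_simp
  refine (norm_integral_le_of_norm_le ?_ (Eventually.of_forall fun x =>
    norm_ray_integrand_le hM t x)).trans (le_of_eq ?_)
  · exact (integrable_exp_mul_exp_neg_exp hα0 hα1 (mul_pos ht (neg_pos.2 hθ))).const_mul M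
  · simp_rw [hsub]
    rw [integral_add_right_eq_self
      (fun y => M * t ^ (-α) * (Real.exp (α * y) * Real.exp (-(-Real.cos θ * Real.exp y)))),
      integral_const_mul]

theorem continuousOn_rayIntegral (hα0 : 0 < α) (hα1 : α < 1) (hθ : Real.cos θ < 0)
    (hΦ : Continuous fun x : ℝ => Φ (x + θ * I))
    (hM : ∀ x : ℝ, ‖Φ (x + θ * I)‖ ≤ M * Real.exp (α * x)) :
    ContinuousOn (rayIntegral θ Φ) (Ioi 0) := by
  intro t₀ ht₀
  have ht₀' : 0 < t₀ := ht₀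
  have hM0 : 0 ≤ M := nonneg_of_mul_nonneg_left ((norm_nonneg _).trans (hM 0)) (Real.exp_pos _)
  refine ContinuousAt.continuousWithinAt (continuousAt_of_dominated
    (bound := fun x => M * (Real.exp (α * x) * Real.exp (-(t₀ / 2 * -Real.cos θ * Real.exp x))))
    (Eventually.of_forall fun t => (continuous_ray_integrand hΦ t).aestronglyMeasurable) ?_
    ((integrable_exp_mul_exp_neg_exp hα0 hα1
      (mul_pos (half_pos ht₀') (neg_pos.2 hθ))).const_mul M)
    (Eventually.of_forall fun x => Continuous.continuousAt (by fun_prop)))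
  filter_upwards [lt_mem_nhds (half_lt_self ht₀')] with t ht
  refine Eventually.of_forall fun x => (norm_ray_integrand_le hM t x).trans ?_
  have : 0 < -Real.cos θ := neg_pos.2 hθ
  gcongr

theorem integrable_laplace_rayIntegral (hα0 : 0 < α) (hα1 : α < 1) (hθ : Real.cos θ < 0)
    (hΦ : Continuous fun x : ℝ => Φ (x + θ * I))
    (hM : ∀ x : ℝ, ‖Φ (x + θ * I)‖ ≤ M * Real.exp (α * x)) {p : ℝ} (hp : 0 < p) :
    Integrable (fun z : ℝ × ℝ => exp (-(p * z.1 : ℝ)) •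
      exp (z.1 * exp (z.2 + θ * I)) • Φ (z.2 + θ * I))
      ((volume.restrict (Ioi 0)).prod volume) := by
  have hc : 0 < -Real.cos θ := neg_pos.2 hθ
  have hcont : Continuous (fun z : ℝ × ℝ => exp (-(p * z.1 : ℝ)) •
      exp (z.1 * exp (z.2 + θ * I)) • Φ (z.2 + θ * I)) :=
    Continuous.smul (by fun_prop) (Continuous.smul (by fun_prop) (hΦ.comp continuous_snd))
  have hnorm : ∀ t x : ℝ, ‖exp (-(p * t : ℝ)) • exp (t * exp (x + θ * I)) • Φ (x + θ * I)‖ =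
      Real.exp (-(p + -Real.cos θ * Real.exp x) * t) * ‖Φ (x + θ * I)‖ := by
    intro t x
    rw [norm_smul, norm_smul, norm_exp_mul_exp, ← ofReal_neg, norm_exp_ofReal, ← mul_assoc,
      ← Real.exp_add]
    ring_nf
  have hneg : ∀ x, -(p + -Real.cos θ * Real.exp x) < 0 := fun x =>
    neg_neg_of_pos (by positivity)
  rw [integrable_prod_iff' hcont.aestronglyMeasurable]
  refine ⟨Eventually.of_forall fun x => ?_, ?_⟩
  · refine (integrable_norm_iff
      (hcont.comp (f := fun t : ℝ => (t, x)) (by fun_prop)).aestronglyMeasurable).1 ?_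
    simp only [Function.comp_def, hnorm]
    exact (integrableOn_exp_mul_Ioi (hneg x) 0).mul_const _
  · simp_rw [hnorm, integral_mul_const, integral_exp_mul_Ioi (hneg _)]
    refine ((integrable_exp_mul_div hα0 hα1 hp hc).const_mul M).mono'
      (Continuous.aestronglyMeasurable ?_) (Eventually.of_forall fun x => ?_)
    · exact (Continuous.div (by fun_prop) (by fun_prop) fun x => (hneg x).ne).mul hΦ.norm
    · have hpos : 0 < p + -Real.cos θ * Real.exp x := by positivity
      rw [mul_zero, Real.exp_zero, neg_div_neg_eq, Real.norm_of_nonneg (by positivity),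
        one_div, inv_mul_eq_div, ← mul_div_assoc]
      gcongr
      exact hM x

theorem integrableOn_exp_smul_rayIntegral (hα0 : 0 < α) (hα1 : α < 1) (hθ : Real.cos θ < 0)
    (hΦ : Continuous fun x : ℝ => Φ (x + θ * I))
    (hM : ∀ x : ℝ, ‖Φ (x + θ * I)‖ ≤ M * Real.exp (α * x)) {p : ℝ} (hp : 0 < p) :
    IntegrableOn (fun t => exp (-(p * t : ℝ)) • rayIntegral θ Φ t) (Ioi 0) := by
  simpa only [integral_smul] using!
    (integrable_laplace_rayIntegral hα0 hα1 hθ hΦ hM hp).integral_prod_left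

/-- Fubini: the Laplace transform of `t ↦ e^{λ t}` at `p` is `1 / (p - λ)`. -/
theorem laplace_rayIntegral [CompleteSpace E] (hα0 : 0 < α) (hα1 : α < 1) (hθ : Real.cos θ < 0)
    (hΦ : Continuous fun x : ℝ => Φ (x + θ * I))
    (hM : ∀ x : ℝ, ‖Φ (x + θ * I)‖ ≤ M * Real.exp (α * x)) {p : ℝ} (hp : 0 < p) :
    ∫ t in Ioi (0 : ℝ), exp (-(p * t : ℝ)) • rayIntegral θ Φ t =
      ∫ x : ℝ, ((p : ℂ) - exp (x + θ * I))⁻¹ • Φ (x + θ * I) := by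
  have hc : 0 < -Real.cos θ := neg_pos.2 hθ
  simp_rw [rayIntegral, ← integral_smul]
  rw [integral_integral_swap (integrable_laplace_rayIntegral hα0 hα1 hθ hΦ hM hp)]
  refine integral_congr_ae (Eventually.of_forall fun x => ?_)
  have hre : (exp (x + θ * I) - p).re < 0 := by
    rw [sub_re, exp_add_mul_I_re, ofReal_re]
    nlinarith [Real.exp_pos x]
  have hint := integral_exp_mul_complex_Ioi hre 0
  simp only [smul_smul]
  rw [integral_smul_const]
  congr 1
  rw [ofReal_zero, mul_zero, exp_zero, neg_div, ← div_neg, neg_sub, one_div] at hint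
  rw [← hint]
  refine integral_congr_ae (Eventually.of_forall fun t => ?_)
  simp only [← exp_add]
  push_cast
  ring_nf

end Ray

/-- The inverse Laplace transform of `λ ↦ Φ (log λ) / λ`, taken along the boundary of the sector
`|arg λ| < γ`. The contour passes through `λ = 0`, where the integrand is integrable. -/
noncomputable def sectorInverse (γ : ℝ) (Φ : ℂ → E) (t : ℝ) : E :=
  (2 * Real.pi * I)⁻¹ • (rayIntegral γ Φ t - rayIntegral (-γ) Φ t)

theorem eq_log_of_exp_eq {p : ℝ} (hp : 0 < p) {z : ℂ} (hz : |z.im| < Real.pi)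
    (h : (p : ℂ) = exp z) : z = Real.log p := by
  rw [ofReal_log hp.le, h, log_exp (abs_lt.1 hz).1 (abs_lt.1 hz).2.le]

theorem norm_inv_smul_le {p : ℝ} {z : ℂ} {x : E} {K : ℝ} (hp : 0 < p)
    (hz : p ≠ Real.exp z.re) (h : ‖x‖ ≤ K) :
    ‖((p : ℂ) - exp z)⁻¹ • x‖ ≤ K / |p - Real.exp z.re| := by
  have h0 : 0 < |p - Real.exp z.re| := abs_pos.2 (sub_ne_zero.2 hz)
  have h1 : |p - Real.exp z.re| ≤ ‖(p : ℂ) - exp z‖ := by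
    have := abs_norm_sub_norm_le (p : ℂ) (exp z)
    rwa [norm_exp, norm_real, Real.norm_of_nonneg hp.le] at this
  rw [norm_smul, norm_inv, inv_mul_eq_div]
  have := (norm_nonneg _).trans h
  gcongr

/-- `Φ` is holomorphic in the strip `|Im z| < c`, where `‖Φ z‖ ≤ min (M e^{α Re z}) N`. In terms
of `λ = e^z` this is the bound `min (M |λ|^α) N` on a sector. -/
structure StripBound (Φ : ℂ → E) (α c M N : ℝ) : Prop where
  differentiableOn : DifferentiableOn ℂ Φ {z | |z.im| < c}
  norm_le_exp : ∀ z : ℂ, |z.im| < c → ‖Φ z‖ ≤ M * Real.exp (α * z.re)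
  norm_le : ∀ z : ℂ, |z.im| < c → ‖Φ z‖ ≤ N

section Sector

variable {α γ c M N : ℝ} {Φ : ℂ → E}

theorem StripBound.continuous_line (h : StripBound Φ α c M N) {θ : ℝ} (hθ : |θ| < c) :
    Continuous fun x : ℝ => Φ (x + θ * I) :=
  h.differentiableOn.continuousOn.comp_continuous (by fun_prop) fun x => by simpa using hθ

theorem StripBound.norm_line_le (h : StripBound Φ α c M N) {θ : ℝ} (hθ : |θ| < c) (x : ℝ) :
    ‖Φ (x + θ * I)‖ ≤ M * Real.exp (α * x) := by
  simpa using h.norm_le_exp (x + θ * I) (by simpa using hθ)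

theorem cos_neg_of_sector (hγ : γ ∈ Ioo (Real.pi / 2) Real.pi) : Real.cos γ < 0 :=
  Real.cos_neg_of_pi_div_two_lt_of_lt hγ.1 (by linarith [hγ.2, Real.pi_pos])

theorem norm_sectorInverse_le (hα0 : 0 < α) (hα1 : α < 1)
    (hγ : γ ∈ Ioo (Real.pi / 2) Real.pi) (hγc : γ < c) (h : StripBound Φ α c M N)
    {t : ℝ} (ht : 0 < t) :
    ‖sectorInverse γ Φ t‖ ≤ M * t ^ (-α) *
      ∫ x : ℝ, Real.exp (α * x) * Real.exp (-(-Real.cos γ * Real.exp x)) := by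
  have hγ0 : 0 < γ := by linarith [hγ.1, Real.pi_pos]
  have hcos := cos_neg_of_sector hγ
  have h1 := norm_rayIntegral_le hα0 hα1 hcos
    (h.norm_line_le (by rwa [abs_of_pos hγ0])) ht
  have h2 := norm_rayIntegral_le hα0 hα1 (θ := -γ) (by rwa [Real.cos_neg])
    (h.norm_line_le (by rwa [abs_neg, abs_of_pos hγ0])) ht
  rw [Real.cos_neg] at h2
  rw [sectorInverse, norm_smul]
  -- `1 / (2 π) ≤ 1 / 2` absorbs the two rays.
  have h3 : ‖(2 * Real.pi * I : ℂ)⁻¹‖ ≤ 2⁻¹ := by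
    rw [norm_inv, norm_mul, norm_mul, norm_I, norm_real, Real.norm_of_nonneg Real.pi_pos.le,
      RCLike.norm_two, mul_one]
    gcongr
    linarith [Real.two_le_pi]
  have h4 := norm_sub_le (rayIntegral γ Φ t) (rayIntegral (-γ) Φ t)
  have := mul_le_mul h3 h4 (norm_nonneg _) (by norm_num)
  linarith

theorem continuousOn_sectorInverse (hα0 : 0 < α) (hα1 : α < 1)
    (hγ : γ ∈ Ioo (Real.pi / 2) Real.pi) (hγc : γ < c) (h : StripBound Φ α c M N) :
    ContinuousOn (sectorInverse γ Φ) (Ioi 0) := by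
  have hγ0 : 0 < γ := by linarith [hγ.1, Real.pi_pos]
  have hcos := cos_neg_of_sector hγ
  have hγc1 : |γ| < c := by rwa [abs_of_pos hγ0]
  have hγc2 : |(-γ)| < c := by rwa [abs_neg]
  exact ((continuousOn_rayIntegral hα0 hα1 hcos (h.continuous_line hγc1)
    (h.norm_line_le hγc1)).sub (continuousOn_rayIntegral hα0 hα1 (by rwa [Real.cos_neg])
    (h.continuous_line hγc2) (h.norm_line_le hγc2))).const_smul _

theorem integrableOn_exp_smul_sectorInverse (hα0 : 0 < α) (hα1 : α < 1)
    (hγ : γ ∈ Ioo (Real.pi / 2) Real.pi) (hγc : γ < c) (h : StripBound Φ α c M N)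
    {p : ℝ} (hp : 0 < p) :
    IntegrableOn (fun t => exp (-(p * t : ℝ)) • sectorInverse γ Φ t) (Ioi 0) := by
  have hγ0 : 0 < γ := by linarith [hγ.1, Real.pi_pos]
  have hcos := cos_neg_of_sector hγ
  have hγc1 : |γ| < c := by rwa [abs_of_pos hγ0]
  have hγc2 : |(-γ)| < c := by rwa [abs_neg]
  have := ((integrableOn_exp_smul_rayIntegral hα0 hα1 hcos (h.continuous_line hγc1)
    (h.norm_line_le hγc1) hp).sub (integrableOn_exp_smul_rayIntegral hα0 hα1
    (by rwa [Real.cos_neg]) (h.continuous_line hγc2) (h.norm_line_le hγc2) hp)).smul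
    (2 * Real.pi * I : ℂ)⁻¹
  refine this.congr (Eventually.of_forall fun t => ?_)
  simp only [Pi.smul_apply, Pi.sub_apply, sectorInverse]
  rw [← smul_sub, smul_comm]

theorem integrable_inv_smul_line (hα0 : 0 < α) (hα1 : α < 1) {θ : ℝ} (hcos : Real.cos θ < 0)
    (hθ : |θ| < c) (h : StripBound Φ α c M N) {p : ℝ} (hp : 0 < p) :
    Integrable fun x : ℝ => ((p : ℂ) - exp (x + θ * I))⁻¹ • Φ (x + θ * I) := by
  have hre : ∀ x : ℝ, p + -Real.cos θ * Real.exp x ≤ ‖(p : ℂ) - exp (x + θ * I)‖ := fun x => by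
    refine le_trans (le_of_eq ?_) (re_le_norm _)
    rw [sub_re, exp_add_mul_I_re, ofReal_re]
    ring
  have hpos : ∀ x : ℝ, 0 < p + -Real.cos θ * Real.exp x := fun x => by
    have := neg_pos.2 hcos
    positivity
  refine ((integrable_exp_mul_div hα0 hα1 hp (neg_pos.2 hcos)).const_mul M).mono'
    (Continuous.aestronglyMeasurable (Continuous.smul (Continuous.inv₀ (by fun_prop) fun x => ?_)
      (h.continuous_line hθ))) (Eventually.of_forall fun x => ?_)
  · exact norm_pos_iff.1 ((hpos x).trans_le (hre x))
  · rw [norm_smul, norm_inv, inv_mul_eq_div, ← mul_div_assoc]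
    have := hpos x
    gcongr
    · exact (norm_nonneg _).trans (h.norm_line_le hθ x)
    · exact h.norm_line_le hθ x
    · exact hre x

/-- The Laplace transform of `sectorInverse γ Φ` is `p ↦ Φ (log p) / p`: exchanging the integrals
leaves Cauchy's formula for the pole at `λ = p`. -/
theorem laplace_sectorInverse [CompleteSpace E] (hα0 : 0 < α) (hα1 : α < 1)
    (hγ : γ ∈ Ioo (Real.pi / 2) Real.pi) (hγc : γ < c) (hc : c ≤ Real.pi)
    (h : StripBound Φ α c M N) {p : ℝ} (hp : 0 < p) :
    ∫ t in Ioi (0 : ℝ), exp (-(p * t : ℝ)) • sectorInverse γ Φ t =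
      (p : ℂ)⁻¹ • Φ (Real.log p) := by
  have hγ0 : 0 < γ := by linarith [hγ.1, Real.pi_pos]
  have hcos := cos_neg_of_sector hγ
  have hcos' : Real.cos (-γ) < 0 := by rwa [Real.cos_neg]
  have hγc1 : |γ| < c := by rwa [abs_of_pos hγ0]
  have hγc2 : |(-γ)| < c := by rwa [abs_neg]
  have hpC : (p : ℂ) ≠ 0 := ofReal_ne_zero.2 hp.ne'
  set x₀ : ℝ := Real.log p with hx₀
  set d : ℂ → ℂ := fun z => (p : ℂ) - exp z with hd
  have hdx : d x₀ = 0 := by simp [hd, hx₀, ← ofReal_exp, Real.exp_log hp]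
  have hderiv : deriv d x₀ = -p := by
    rw [hd, deriv_const_sub, Complex.deriv_exp, ← ofReal_exp, Real.exp_log hp]
  have hopen : IsOpen {z : ℂ | |z.im| < c} :=
    isOpen_lt (continuous_abs.comp continuous_im) continuous_const
  have hdne : ∀ z : ℂ, |z.im| < c → z ≠ x₀ → d z ≠ 0 := fun z hz hne h0 =>
    hne (eq_log_of_exp_eq hp (hz.trans_le hc) (sub_eq_zero.1 h0))
  have hslope : ∀ z : ℂ, z ≠ x₀ → dslope d x₀ z = (z - x₀)⁻¹ * d z := fun z hne => by
    rw [dslope_of_ne _ hne, slope_def_module, hdx, sub_zero, smul_eq_mul]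
  have hdslope : DifferentiableOn ℂ (dslope d x₀) {z | |z.im| < c} :=
    (differentiableOn_dslope (hopen.mem_nhds (by simpa using hγ0.trans hγc))).2 (by fun_prop)
  -- `z - x₀` divides `p - e^z` exactly once; the quotient is `dslope d x₀`, which has no zeros in
  -- the strip.
  have hmain := integral_strip_sub_eq (Θ := fun z => (dslope d x₀ z)⁻¹ • Φ z)
    (Ψ := fun z => (d z)⁻¹ • Φ z) (x₀ := x₀)
    (g := fun L => N / |p - Real.exp L| + M * Real.exp (α * -L) / |p - Real.exp (-L)|)
    hγ0 hγc (hdslope.inv (fun z hz => ?_) |>.smul h.differentiableOn) (fun z hz hne => ?_) ?_ ?_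
    (integrable_inv_smul_line hα0 hα1 hcos hγc1 h hp)
    (by exact integrable_inv_smul_line hα0 hα1 hcos' hγc2 h hp)
  · rw [dslope_same, hderiv] at hmain
    simp_rw [sectorInverse, smul_comm _ (2 * Real.pi * I : ℂ)⁻¹, smul_sub]
    rw [integral_sub, integral_smul, integral_smul,
      laplace_rayIntegral hα0 hα1 hcos (h.continuous_line hγc1) (h.norm_line_le hγc1) hp,
      laplace_rayIntegral hα0 hα1 hcos' (h.continuous_line hγc2) (h.norm_line_le hγc2) hp,
      ← smul_sub, hmain, smul_smul, smul_smul]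
    · congr 1
      have := Real.pi_ne_zero
      field_simp
    · exact (integrableOn_exp_smul_rayIntegral hα0 hα1 hcos (h.continuous_line hγc1)
        (h.norm_line_le hγc1) hp).smul _
    · exact (integrableOn_exp_smul_rayIntegral hα0 hα1 hcos' (h.continuous_line hγc2)
        (h.norm_line_le hγc2) hp).smul _
  · rcases eq_or_ne z x₀ with rfl | hne
    · rw [dslope_same, hderiv]
      exact neg_ne_zero.2 hpC
    · rw [hslope z hne]
      exact mul_ne_zero (inv_ne_zero (sub_ne_zero.2 hne)) (hdne z hz hne)
  · have : z - x₀ ≠ 0 := sub_ne_zero.2 hne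
    simp only [hslope z hne]
    rw [smul_smul, mul_inv, inv_inv, inv_mul_cancel_left₀ this]
  · have h1 : Tendsto (fun L => N / |p - Real.exp L|) atTop (𝓝 0) :=
      tendsto_const_nhds.div_atTop (tendsto_abs_atBot_atTop.comp
        (tendsto_atBot_add_const_left _ p (tendsto_neg_atTop_atBot.comp Real.tendsto_exp_atTop)))
    have h2 : Tendsto (fun L => M * Real.exp (α * -L)) atTop (𝓝 0) := by
      simpa using (Real.tendsto_exp_atBot.comp
        (tendsto_neg_atTop_atBot.const_mul_atBot hα0)).const_mul M
    have h3 : Tendsto (fun L => |p - Real.exp (-L)|) atTop (𝓝 |p - 0|) :=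
      (tendsto_const_nhds.sub (Real.tendsto_exp_atBot.comp tendsto_neg_atTop_atBot)).abs
    simpa using h1.add (h2.div h3 (by simpa using hp.ne'))
  · have hM : 0 ≤ M := nonneg_of_mul_nonneg_left ((norm_nonneg _).trans
      (h.norm_le_exp x₀ (by simpa using hγ0.trans hγc))) (Real.exp_pos _)
    have hN : 0 ≤ N := (norm_nonneg _).trans (h.norm_le x₀ (by simpa using hγ0.trans hγc))
    filter_upwards [eventually_gt_atTop |x₀|] with L hL y hy
    have hne1 : p ≠ Real.exp L := fun h => by
      rw [hx₀, h, Real.log_exp] at hL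
      exact (le_abs_self L).not_gt hL
    have hne2 : p ≠ Real.exp (-L) := fun h => by
      rw [hx₀, h, Real.log_exp, abs_neg] at hL
      exact (le_abs_self L).not_gt hL
    refine ⟨?_, ?_⟩
    · have hz : |((L : ℂ) + y * I).im| < c := by simpa using hy.trans_lt hγc
      have := norm_inv_smul_le (z := (L : ℂ) + y * I) hp (by simpa using hne1) (h.norm_le _ hz)
      rw [show ((L : ℂ) + y * I).re = L by simp] at this
      exact this.trans (le_add_of_nonneg_right (by positivity))
    · have hz : |(((-L : ℝ) : ℂ) + y * I).im| < c := by simpa using hy.trans_lt hγc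
      have := norm_inv_smul_le (z := ((-L : ℝ) : ℂ) + y * I) hp (by simpa using hne2) (h.norm_le_exp _ hz)
      rw [show (((-L : ℝ) : ℂ) + y * I).re = -L by simp] at this
      exact this.trans (le_add_of_nonneg_left (by positivity))

end Sector

end ContourIntegrals

/-! ### Resolvents of sectorial operators -/

section Resolvents

variable {X : Type*} [NormedAddCommGroup X] [NormedSpace ℂ X] {A : X →ₗ.[ℂ] X}

theorem isResolventAt_resolvent {z : ℂ} (hz : z ∈ resolventSet A) :
    IsResolventAt A z (resolvent A z) := by
  rw [resolvent, dif_pos hz]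
  exact hz.choose_spec

/-- The resolvent identity. -/
theorem resolvent_apply_eq {z w : ℂ} (hz : z ∈ resolventSet A) (hw : w ∈ resolventSet A) (x : X) :
    resolvent A z x = resolvent A w x + (w - z) • resolvent A z (resolvent A w x) := by
  obtain ⟨hd, hx⟩ := (isResolventAt_resolvent hw).1 x
  have h := (isResolventAt_resolvent hz).2 ⟨resolvent A w x, hd⟩
  have h' : z • resolvent A w x - A ⟨resolvent A w x, hd⟩ =
      x - (w - z) • resolvent A w x := by
    nth_rewrite 3 [← hx]
    rw [sub_smul]
    abel
  rw [h', map_sub, map_smul, sub_eq_iff_eq_add] at h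
  exact h

theorem isOpen_sector {γ : ℝ} (hγ : γ < Real.pi) : IsOpen (sector γ) := by
  have : sector γ = Complex.slitPlane ∩ (fun z => |z.arg|) ⁻¹' Iio γ := by
    ext z
    simp only [sector, mem_ofPred_eq, mem_inter_iff, Complex.mem_slitPlane_iff_arg, mem_preimage,
      mem_Iio]
    refine ⟨fun h => ⟨⟨fun h' => ?_, h.1⟩, h.2⟩, fun h => ⟨h.1.2, h.2⟩⟩
    have := (le_abs_self _).trans_lt h.2
    linarith
  rw [this]
  exact ContinuousOn.isOpen_inter_preimage
    (fun z hz => (Complex.continuousAt_arg hz).abs.continuousWithinAt) Complex.isOpen_slitPlane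
    isOpen_Iio

/-- The resolvent bounds on a sector that are used below: `‖(z - A)⁻¹‖` is at most `C / |z|`, and
it is bounded because `0` belongs to the resolvent set. -/
structure SectorBound (A : X →ₗ.[ℂ] X) (γ C M : ℝ) : Prop where
  subset : sector γ ⊆ resolventSet A
  norm_le_div : ∀ z ∈ sector γ, ‖resolvent A z‖ ≤ C / ‖z‖
  norm_le : ∀ z ∈ sector γ, ‖resolvent A z‖ ≤ M
  nonneg : 0 ≤ C

/-- Boundedness near the vertex: `(z - A)⁻¹ = R₀ - z (z - A)⁻¹ R₀` with `R₀ = (0 - A)⁻¹`. -/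
theorem exists_sectorBound {γ C : ℝ} (h0 : (0 : ℂ) ∈ resolventSet A)
    (hsub : sector γ ⊆ resolventSet A) (hC : ∀ z ∈ sector γ, ‖resolvent A z‖ ≤ C / ‖z‖)
    (hC0 : 0 ≤ C) : ∃ M, 0 ≤ M ∧ SectorBound A γ C M := by
  refine ⟨(1 + C) * ‖resolvent A 0‖, by positivity, hsub, hC, fun z hz => ?_, hC0⟩
  refine ContinuousLinearMap.opNorm_le_bound _ (by positivity) fun x => ?_
  rw [resolvent_apply_eq (hsub hz) h0 x, zero_sub]
  have hz0 : 0 < ‖z‖ := norm_pos_iff.2 hz.1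
  have h1 : ‖-z • resolvent A z (resolvent A 0 x)‖ ≤ C * ‖resolvent A 0 x‖ := by
    rw [norm_smul, norm_neg]
    calc ‖z‖ * ‖resolvent A z (resolvent A 0 x)‖
        ≤ ‖z‖ * (C / ‖z‖ * ‖resolvent A 0 x‖) := by
          gcongr
          exact (resolvent A z).le_of_opNorm_le (hC z hz) _
      _ = C * ‖resolvent A 0 x‖ := by field_simp
  calc ‖resolvent A 0 x + -z • resolvent A z (resolvent A 0 x)‖
      ≤ ‖resolvent A 0 x‖ + C * ‖resolvent A 0 x‖ := (norm_add_le _ _).trans (by gcongr)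
    _ = (1 + C) * ‖resolvent A 0 x‖ := by ring
    _ ≤ (1 + C) * (‖resolvent A 0‖ * ‖x‖) := by
        gcongr
        exact (resolvent A 0).le_opNorm x
    _ = _ := by ring

namespace SectorBound

variable {γ C M : ℝ}

theorem continuousAt_resolvent (h : SectorBound A γ C M) (hγ : γ < Real.pi) {z : ℂ}
    (hz : z ∈ sector γ) (x : X) : ContinuousAt (fun w => resolvent A w x) z := by
  rw [ContinuousAt, tendsto_iff_norm_sub_tendsto_zero]
  have hlim : Tendsto (fun w : ℂ => ‖z - w‖ * (M * ‖resolvent A z x‖)) (𝓝 z) (𝓝 0) := by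
    have : Continuous fun w : ℂ => ‖z - w‖ * (M * ‖resolvent A z x‖) := by fun_prop
    simpa using this.tendsto z
  refine squeeze_zero' (Eventually.of_forall fun _ => norm_nonneg _) ?_ hlim
  filter_upwards [(isOpen_sector hγ).mem_nhds hz] with w hw
  rw [resolvent_apply_eq (h.subset hw) (h.subset hz) x, add_sub_cancel_left, norm_smul]
  gcongr
  exact (resolvent A w).le_of_opNorm_le (h.norm_le w hw) _

theorem differentiableOn_resolvent (h : SectorBound A γ C M) (hγ : γ < Real.pi) (x : X) :
    DifferentiableOn ℂ (fun w => resolvent A w x) (sector γ) := by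
  intro z hz
  -- By the resolvent identity the difference quotient is `-(w - A)⁻¹ (z - A)⁻¹ x`.
  refine (HasDerivAt.differentiableAt (f' := -resolvent A z (resolvent A z x))
    (hasDerivAt_iff_tendsto_slope.2 ?_)).differentiableWithinAt
  refine (((h.continuousAt_resolvent hγ hz (resolvent A z x)).neg.tendsto).mono_left
    nhdsWithin_le_nhds).congr' ?_
  filter_upwards [self_mem_nhdsWithin,
    nhdsWithin_le_nhds ((isOpen_sector hγ).mem_nhds hz)] with w hne hw
  have hne' : w - z ≠ 0 := sub_ne_zero.2 hne
  rw [slope_def_module, resolvent_apply_eq (h.subset hw) (h.subset hz) x, add_sub_cancel_left,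
    ← neg_sub w z, neg_smul, smul_neg, inv_smul_smul₀ hne']
  rfl

end SectorBound

theorem exp_mul_mem_sector {α γ : ℝ} (hα : 0 < α) (hγ : γ ≤ Real.pi) {z : ℂ}
    (hz : |z.im| < γ / α) : Complex.exp (α * z) ∈ sector γ := by
  refine ⟨Complex.exp_ne_zero _, ?_⟩
  have him : |((α : ℂ) * z).im| < γ := by
    rw [Complex.im_ofReal_mul, abs_mul, abs_of_pos hα, mul_comm]
    exact (lt_div_iff₀ hα).1 hz
  have h2 := abs_lt.1 (him.trans_le hγ)
  rw [← Complex.log_im, Complex.log_exp h2.1 h2.2.le]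
  exact him

/-- The function `λ^α (λ^α - A)⁻¹ a` in the coordinate `z = log λ`. -/
theorem SectorBound.stripBound {γ C M : ℝ} (h : SectorBound A γ C M) (hγ : γ < Real.pi) {α c : ℝ}
    (hα : 0 < α) (hc : c ≤ γ / α) (a : X) :
    StripBound (fun z => Complex.exp (α * z) • resolvent A (Complex.exp (α * z)) a) α c
      (M * ‖a‖) (C * ‖a‖) where
  differentiableOn := by
    refine DifferentiableOn.smul (by fun_prop) ?_
    exact (h.differentiableOn_resolvent hγ a).comp (by fun_prop) fun z hz =>
      exp_mul_mem_sector hα hγ.le (lt_of_lt_of_le hz hc)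
  norm_le_exp z hz := by
    have hmem := exp_mul_mem_sector hα hγ.le (hz.trans_le hc)
    rw [norm_smul, Complex.norm_exp, Complex.re_ofReal_mul, mul_comm]
    gcongr
    exact (resolvent A _).le_of_opNorm_le (h.norm_le _ hmem) _
  norm_le z hz := by
    have hmem := exp_mul_mem_sector hα hγ.le (hz.trans_le hc)
    have hpos : 0 < ‖Complex.exp (α * z)‖ := norm_pos_iff.2 hmem.1
    rw [norm_smul]
    calc _ ≤ ‖Complex.exp (α * z)‖ * (C / ‖Complex.exp (α * z)‖ * ‖a‖) := by
          gcongr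
          exact (resolvent A _).le_of_opNorm_le (h.norm_le_div _ hmem) _
      _ = C * ‖a‖ := by field_simp

theorem ofReal_mem_sector {γ x : ℝ} (hγ : 0 < γ) (hx : 0 < x) : (x : ℂ) ∈ sector γ :=
  ⟨Complex.ofReal_ne_zero.2 hx.ne', by rwa [Complex.arg_ofReal_of_nonneg hx.le, abs_zero]⟩

end Resolvents

/-! ### The Laplace transform of a truncated fractional integral -/

open scoped Convolution

theorem integrableOn_rpow_mul_exp_neg_mul {α p : ℝ} (hα : 0 < α) (hp : 0 < p) :
    IntegrableOn (fun t : ℝ => t ^ (α - 1) * Real.exp (-(p * t))) (Ioi 0) := by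
  refine not_imp_comm.1 integral_undef ?_
  rw [Real.integral_rpow_mul_exp_neg_mul_Ioi hα hp]
  have := Real.Gamma_pos_of_pos hα
  positivity

section Convolution

variable {X : Type*} [NormedAddCommGroup X] [NormedSpace ℝ X]

/-- The weighted convolution `e^{-pt} ∫₀ᵗ (t - s)^{α-1} w(s) ds`, where `w` is cut off outside
`(0, T)`, as a convolution of integrable functions on the line. -/
noncomputable def weightedConv (α T : ℝ) (w : ℝ → X) (p : ℝ) : ℝ → X :=
  (Ioi (0 : ℝ)).indicator (fun t => t ^ (α - 1) * Real.exp (-(p * t)))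
    ⋆[ContinuousLinearMap.lsmul ℝ ℝ, volume]
      (Ioo (0 : ℝ) T).indicator (fun t => Real.exp (-(p * t)) • w t)

variable {α T : ℝ} {w : ℝ → X}

theorem integrable_exp_smul_of_integrableOn_Ioo (hw : IntegrableOn w (Ioo 0 T)) (p : ℝ) :
    IntegrableOn (fun t => Real.exp (-(p * t)) • w t) (Ioo 0 T) := by
  have hcont : ContinuousOn (fun t : ℝ => Real.exp (-(p * t))) (Icc 0 T) := by fun_prop
  rw [← integrableOn_Icc_iff_integrableOn_Ioo] at hw ⊢
  exact hw.continuousOn_smul hcont isCompact_Icc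

theorem integrable_weightedConv (hα : 0 < α) (hw : IntegrableOn w (Ioo 0 T)) {p : ℝ} (hp : 0 < p) :
    Integrable (weightedConv α T w p) :=
  Integrable.integrable_convolution _
    ((integrable_indicator_iff measurableSet_Ioi).2 (integrableOn_rpow_mul_exp_neg_mul hα hp))
    ((integrable_indicator_iff measurableSet_Ioo).2 (integrable_exp_smul_of_integrableOn_Ioo hw p))

theorem integral_weightedConv [CompleteSpace X] (hα : 0 < α) (hw : IntegrableOn w (Ioo 0 T))
    {p : ℝ} (hp : 0 < p) :
    ∫ t, weightedConv α T w p t =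
      ((1 / p) ^ α * Real.Gamma α) • ∫ t in Ioo 0 T, Real.exp (-(p * t)) • w t := by
  rw [weightedConv, integral_convolution _
    ((integrable_indicator_iff measurableSet_Ioi).2 (integrableOn_rpow_mul_exp_neg_mul hα hp))
    ((integrable_indicator_iff measurableSet_Ioo).2 (integrable_exp_smul_of_integrableOn_Ioo hw p)),
    integral_indicator measurableSet_Ioi, integral_indicator measurableSet_Ioo,
    Real.integral_rpow_mul_exp_neg_mul_Ioi hα hp]
  rfl

theorem weightedConv_eq_exp_smul (p r t : ℝ) :
    weightedConv α T w p t = Real.exp (-((p - r) * t)) • weightedConv α T w r t := by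
  simp only [weightedConv, convolution_def, ← integral_smul]
  refine integral_congr_ae (Eventually.of_forall fun s => ?_)
  by_cases hs : s ∈ Ioi (0 : ℝ)
  · by_cases hts : t - s ∈ Ioo 0 T
    · simp only [indicator_of_mem hs, indicator_of_mem hts, ContinuousLinearMap.lsmul_apply,
        smul_smul]
      congr 1
      rw [mul_assoc, ← Real.exp_add, mul_assoc, ← Real.exp_add, mul_left_comm, ← Real.exp_add]
      ring_nf
    · simp [indicator_of_notMem hts]
  · simp [indicator_of_notMem hs]

theorem weightedConv_eq_zero {p t : ℝ} (ht : t ≤ 0) : weightedConv α T w p t = 0 := by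
  rw [weightedConv, convolution_def]
  refine integral_eq_zero_of_ae (Eventually.of_forall fun s => ?_)
  by_cases hs : s ∈ Ioi (0 : ℝ)
  · have hts : t - s ∉ Ioo 0 T := fun h => by
      have h1 := h.1
      have h2 : 0 < s := hs
      linarith
    simp [indicator_of_notMem hts]
  · simp [indicator_of_notMem hs]

theorem weightedConv_eq_of_mem {p t : ℝ} (ht : t ∈ Ioo 0 T) :
    weightedConv α T w p t =
      Real.exp (-(p * t)) • ∫ s in (0 : ℝ)..t, (t - s) ^ (α - 1) • w s := by
  rw [weightedConv, convolution_eq_swap, intervalIntegral.integral_of_le ht.1.le,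
    integral_Ioc_eq_integral_Ioo, ← integral_smul, ← integral_indicator measurableSet_Ioo]
  refine integral_congr_ae (Eventually.of_forall fun s => ?_)
  by_cases hs : s ∈ Ioo 0 t
  · have h1 : t - s ∈ Ioi (0 : ℝ) := sub_pos.2 hs.2
    have h2 : s ∈ Ioo 0 T := ⟨hs.1, hs.2.trans ht.2⟩
    simp only [indicator_of_mem hs, indicator_of_mem h1, indicator_of_mem h2,
      ContinuousLinearMap.lsmul_apply, smul_smul]
    congr 1
    rw [mul_assoc, ← Real.exp_add, mul_comm]
    ring_nf
  · simp only [indicator_of_notMem hs]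
    by_cases h1 : t - s ∈ Ioi (0 : ℝ)
    · have h2 : s ∉ Ioo 0 T := fun h => hs ⟨h.1, sub_pos.1 h1⟩
      simp [indicator_of_notMem h2]
    · simp [indicator_of_notMem h1]

/-- The Laplace transform of the fractional integral, with both functions truncated to `(0, T)`:
the error comes from `t ≥ T` and is exponentially small. -/
theorem exists_laplace_conv_truncation_bound [CompleteSpace X] (hα : 0 < α) (hT : 0 < T)
    (hw : IntegrableOn w (Ioo 0 T)) :
    ∃ K, ∀ p : ℝ, 1 ≤ p →
      ‖(∫ t in Ioo 0 T, Real.exp (-(p * t)) • ∫ s in (0 : ℝ)..t, (t - s) ^ (α - 1) • w s) -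
        ((1 / p) ^ α * Real.Gamma α) • ∫ t in Ioo 0 T, Real.exp (-(p * t)) • w t‖ ≤
      K * Real.exp (-(p * T)) := by
  refine ⟨Real.exp T * ∫ t, ‖weightedConv α T w 1 t‖, fun p hp => ?_⟩
  have hp0 : 0 < p := by linarith
  have hint := integrable_weightedConv hα hw hp0
  have h1 : ∫ t in Ioo 0 T, Real.exp (-(p * t)) • ∫ s in (0 : ℝ)..t, (t - s) ^ (α - 1) • w s =
      ∫ t in Iio T, weightedConv α T w p t := by
    have h0 : ∫ t in Iic 0, weightedConv α T w p t = 0 :=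
      setIntegral_eq_zero_of_forall_eq_zero fun t ht => weightedConv_eq_zero ht
    have hdisj : Disjoint (Iic 0) (Ioo 0 T) :=
      Set.disjoint_left.2 fun t ht ht' => (not_lt.2 ht) ht'.1
    rw [← Iic_union_Ioo_eq_Iio hT, setIntegral_union hdisj measurableSet_Ioo hint.integrableOn
      hint.integrableOn, h0, zero_add]
    exact setIntegral_congr_fun measurableSet_Ioo fun t ht => (weightedConv_eq_of_mem ht).symm
  have h2 := integral_add_compl (measurableSet_Iio (a := T)) hint
  rw [h1, ← integral_weightedConv hα hw hp0, ← h2, sub_add_cancel_left, norm_neg, compl_Iio]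
  have h3 : ∀ t ∈ Ici T, ‖weightedConv α T w p t‖ ≤
      Real.exp (-((p - 1) * T)) * ‖weightedConv α T w 1 t‖ := fun t ht => by
    rw [weightedConv_eq_exp_smul p 1, norm_smul, Real.norm_of_nonneg (Real.exp_pos _).le]
    have : T ≤ t := ht
    have : 0 ≤ p - 1 := by linarith
    gcongr
  have hint1 := (integrable_weightedConv hα hw one_pos).norm
  calc ‖∫ t in Ici T, weightedConv α T w p t‖
      ≤ ∫ t in Ici T, Real.exp (-((p - 1) * T)) * ‖weightedConv α T w 1 t‖ :=
        norm_integral_le_of_norm_le (hint1.const_mul _).integrableOn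
          ((ae_restrict_mem measurableSet_Ici).mono h3)
    _ = Real.exp (-((p - 1) * T)) * ∫ t in Ici T, ‖weightedConv α T w 1 t‖ :=
        integral_const_mul _ _
    _ ≤ Real.exp (-((p - 1) * T)) * ∫ t, ‖weightedConv α T w 1 t‖ := by
        refine mul_le_mul_of_nonneg_left (setIntegral_le_integral hint1 ?_) (Real.exp_pos _).le
        exact Eventually.of_forall fun _ => norm_nonneg _
    _ = _ := by
        rw [mul_right_comm, ← Real.exp_add]
        ring_nf

end Convolution

/-! ### Strong solutions -/

section StrongSolutions

variable {X : Type*} [NormedAddCommGroup X] [NormedSpace ℂ X] {A : X →ₗ.[ℂ] X}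

theorem setIntegral_Ioo_exp_neg_mul_smul [CompleteSpace X] {p T : ℝ} (hp : 0 < p) (hT : 0 < T) (a : X) :
    ∫ t in Ioo 0 T, Real.exp (-(p * t)) • a = ((1 - Real.exp (-(p * T))) / p) • a := by
  rw [integral_smul_const, ← integral_Ioc_eq_integral_Ioo, ← intervalIntegral.integral_of_le hT.le]
  congr 1
  have : ∀ t : ℝ, Real.exp (-(p * t)) = Real.exp (-p * t) := fun t => by ring_nf
  simp_rw [this]
  rw [intervalIntegral.integral_comp_mul_left (fun t => Real.exp t) (neg_ne_zero.2 hp.ne'),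
    integral_exp, mul_zero, Real.exp_zero, smul_eq_mul]
  field_simp
  ring

/-- The resolvent turns the equation, truncated to `(0, T)`, into
`û(p) = p^{α-1} (p^α - A)⁻¹ a + O(e^{-pT})`. -/
theorem IsStrongSolution.exists_laplace_bound [CompleteSpace X] {γ C M α T : ℝ} {q : ℝ≥0∞}
    {a : X} {u : ℝ → X}
    (hγ : 0 < γ) (h : SectorBound A γ C M) (hα : 0 < α) (hq : 1 ≤ q) (hT : 0 < T)
    (hu : IsStrongSolution A α q T a u) :
    IntegrableOn u (Ioo 0 T) ∧ ∃ K, ∀ p : ℝ, 1 ≤ p →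
      ‖(∫ t in Ioo 0 T, Real.exp (-(p * t)) • u t) -
        (p ^ α / p) • resolvent A ((p ^ α : ℝ) : ℂ) a‖ ≤ K * Real.exp (-(p * T)) := by
  obtain ⟨w, ⟨hu, hw, hAu⟩, -, hJ⟩ := hu
  have hu : IntegrableOn u (Ioo 0 T) := hu.integrable hq
  have hw : IntegrableOn w (Ioo 0 T) := hw.integrable hq
  refine ⟨hu, ?_⟩
  obtain ⟨K, hK⟩ := exists_laplace_conv_truncation_bound hα hT hw
  have hΓ := Real.Gamma_pos_of_pos hα
  refine ⟨C * (‖a‖ + (Real.Gamma α)⁻¹ * K), fun p hp => ?_⟩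
  have hp0 : 0 < p := by linarith
  have hz0 : 0 < p ^ α := Real.rpow_pos_of_pos hp0 α
  set z : ℝ := p ^ α with hz
  have hzs : (z : ℂ) ∈ sector γ := ofReal_mem_sector hγ hz0
  set R := resolvent A (z : ℂ)
  have hRz : ∀ x : X, ‖z • R x‖ ≤ C * ‖x‖ := fun x => by
    rw [norm_smul, Real.norm_of_nonneg hz0.le]
    have h1 := R.le_of_opNorm_le (h.norm_le_div _ hzs) x
    rw [Complex.norm_real, Real.norm_of_nonneg hz0.le] at h1
    calc z * ‖R x‖ ≤ z * (C / z * ‖x‖) := by gcongr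
      _ = C * ‖x‖ := by field_simp
  have hRr : ∀ (r : ℝ) (x : X), R (r • x) = r • R x := fun r x => by
    rw [← Complex.coe_smul, map_smul, Complex.coe_smul]
  have hup := integrable_exp_smul_of_integrableOn_Ioo hu p
  have hwp := integrable_exp_smul_of_integrableOn_Ioo hw p
  set û := ∫ t in Ioo 0 T, Real.exp (-(p * t)) • u t
  set ŵ := ∫ t in Ioo 0 T, Real.exp (-(p * t)) • w t
  set tail := (∫ t in Ioo 0 T, Real.exp (-(p * t)) • ∫ s in (0 : ℝ)..t, (t - s) ^ (α - 1) • w s) -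
        ((1 / p) ^ α * Real.Gamma α) • ŵ with htail
  -- Away from a null set `R (z u - A u) = u`; this is integrated against `e^{-pt}`.
  have hres : R (z • û - ŵ) = û := by
    have hzup : IntegrableOn (fun t => z • Real.exp (-(p * t)) • u t) (Ioo 0 T) := hup.smul z
    have hzsub : IntegrableOn (fun t => z • Real.exp (-(p * t)) • u t -
        Real.exp (-(p * t)) • w t) (Ioo 0 T) := hzup.sub hwp
    have h1 : z • û - ŵ = ∫ t in Ioo 0 T, (z • Real.exp (-(p * t)) • u t -
        Real.exp (-(p * t)) • w t) := by
        rw [integral_sub hzup hwp, integral_smul]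
    rw [h1, ← R.integral_comp_comm hzsub]
    refine integral_congr_ae ?_
    filter_upwards [hAu] with t ht
    obtain ⟨hd, hAt⟩ := ht
    have h2 := (isResolventAt_resolvent (h.subset hzs)).2 ⟨u t, hd⟩
    rw [hAt, Complex.coe_smul] at h2
    rw [smul_comm, ← smul_sub, hRr, h2]
  -- the integrated equation `u = a + J^α w` on `(0, T)`
  have heq : û = ((1 - Real.exp (-(p * T))) / p) • a + (Real.Gamma α)⁻¹ •
      ∫ t in Ioo 0 T, Real.exp (-(p * t)) • ∫ s in (0 : ℝ)..t, (t - s) ^ (α - 1) • w s := by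
    have hac : IntegrableOn (fun _ : ℝ => a) (Ioo 0 T) := integrableOn_const (by simp)
    have hap := integrable_exp_smul_of_integrableOn_Ioo hac p
    rw [← setIntegral_Ioo_exp_neg_mul_smul hp0 hT, ← integral_smul, ← sub_eq_iff_eq_add',
      ← integral_sub hup hap]
    refine integral_congr_ae ?_
    filter_upwards [hJ] with t ht
    rw [← smul_sub, ht, fracIntegral, smul_comm]
  have herr : z • û - ŵ = (z / p) • a +
      z • ((Real.Gamma α)⁻¹ • tail - (Real.exp (-(p * T)) / p) • a) := by
    have h3 : (1 / p) ^ α = z⁻¹ := by rw [one_div, Real.inv_rpow hp0.le]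
    rw [heq, htail, h3]
    have h4 : ŵ = (z * ((Real.Gamma α)⁻¹ * (z⁻¹ * Real.Gamma α))) • ŵ := by
      rw [show z * ((Real.Gamma α)⁻¹ * (z⁻¹ * Real.Gamma α)) = 1 by field_simp, one_smul]
    nth_rewrite 1 [h4]
    simp only [smul_sub, smul_add, smul_smul, sub_div, sub_smul]
    rw [show z * (1 / p) = z / p by ring]
    abel
  have hfin : û - (z / p) • R a =
      z • R ((Real.Gamma α)⁻¹ • tail - (Real.exp (-(p * T)) / p) • a) := by
    nth_rewrite 1 [← hres]
    rw [herr, map_add, hRr, hRr, add_sub_cancel_left]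
  rw [hfin]
  refine (hRz _).trans ?_
  rw [mul_assoc]
  refine mul_le_mul_of_nonneg_left ?_ h.nonneg
  refine (norm_sub_le _ _).trans ?_
  rw [norm_smul, norm_smul, Real.norm_of_nonneg (by positivity), Real.norm_of_nonneg
    (by positivity)]
  have h5 : Real.exp (-(p * T)) / p ≤ Real.exp (-(p * T)) := div_le_self (Real.exp_pos _).le hp
  calc (Real.Gamma α)⁻¹ * ‖tail‖ + Real.exp (-(p * T)) / p * ‖a‖
      ≤ (Real.Gamma α)⁻¹ * (K * Real.exp (-(p * T))) + Real.exp (-(p * T)) * ‖a‖ := by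
        gcongr
        exact hK p hp
    _ = _ := by ring

/-- The solution operator `S(t)` applied to `a`: the inverse Laplace transform of
`λ ↦ λ^{α-1} (λ^α - A)⁻¹ a`, taken along the boundary of the sector `|arg λ| < γ`. -/
noncomputable def solutionOp (A : X →ₗ.[ℂ] X) (α γ : ℝ) (a : X) : ℝ → X :=
  sectorInverse γ fun z => Complex.exp (α * z) • resolvent A (Complex.exp (α * z)) a

section SolutionOp

variable {γ γ' c C M α : ℝ}

theorem integrableOn_exp_smul_solutionOp (h : SectorBound A γ' C M) (hγ' : γ' < Real.pi)
    (hα0 : 0 < α) (hα1 : α < 1) (hγ : γ ∈ Ioo (Real.pi / 2) Real.pi) (hγc : γ < c)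
    (hc' : c ≤ γ' / α) (a : X) {p : ℝ} (hp : 0 < p) :
    IntegrableOn (fun t => Real.exp (-(p * t)) • solutionOp A α γ a t) (Ioi 0) := by
  refine (integrableOn_exp_smul_sectorInverse hα0 hα1 hγ hγc (h.stripBound hγ' hα0 hc' a) hp).congr
    (Eventually.of_forall fun t => ?_)
  simp only [← Complex.ofReal_neg, ← Complex.ofReal_exp, Complex.coe_smul]
  rfl

theorem laplace_solutionOp [CompleteSpace X] (h : SectorBound A γ' C M) (hγ' : γ' < Real.pi)
    (hα0 : 0 < α) (hα1 : α < 1) (hγ : γ ∈ Ioo (Real.pi / 2) Real.pi) (hγc : γ < c)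
    (hc : c ≤ Real.pi) (hc' : c ≤ γ' / α) (a : X) {p : ℝ} (hp : 0 < p) :
    ∫ t in Ioi (0 : ℝ), Real.exp (-(p * t)) • solutionOp A α γ a t =
      (p ^ α / p) • resolvent A ((p ^ α : ℝ) : ℂ) a := by
  have hlap := laplace_sectorInverse hα0 hα1 hγ hγc hc (h.stripBound hγ' hα0 hc' a) hp
  simp only [← Complex.ofReal_neg, ← Complex.ofReal_exp, Complex.coe_smul, ← Complex.ofReal_mul,
    ← Complex.ofReal_inv, mul_comm α, ← Real.rpow_def_of_pos hp, smul_smul] at hlap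
  rw [div_eq_inv_mul, ← hlap]
  simp only [solutionOp, mul_comm]

/-- Every strong solution on `(0, T)` agrees with `S(t) a`: cutting it off at `T` changes its
Laplace transform by `O(e^{-pT})` only. -/
theorem IsStrongSolution.ae_eq_solutionOp [CompleteSpace X] (h : SectorBound A γ' C M)
    (hγ' : γ' < Real.pi)
    (hγ0 : 0 < γ') (hα0 : 0 < α) (hα1 : α < 1) (hγ : γ ∈ Ioo (Real.pi / 2) Real.pi) (hγc : γ < c)
    (hc : c ≤ Real.pi) (hc' : c ≤ γ' / α) {q : ℝ≥0∞} (hq : 1 ≤ q) {T : ℝ} (hT : 0 < T) {a : X}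
    {u : ℝ → X} (hu : IsStrongSolution A α q T a u) :
    u =ᵐ[volume.restrict (Ioo 0 T)] solutionOp A α γ a := by
  obtain ⟨huint, K, hK⟩ := hu.exists_laplace_bound hγ0 h hα0 hq hT
  set S := solutionOp A α γ a
  have hcut : ∀ p : ℝ, (fun t => Real.exp (-(p * t)) • (Ioo 0 T).indicator u t) =
      (Ioo 0 T).indicator fun t => Real.exp (-(p * t)) • u t := fun p => by
    funext t
    by_cases ht : t ∈ Ioo 0 T
    · simp [indicator_of_mem ht]
    · simp [indicator_of_notMem ht]
  have hint : ∀ p : ℝ, IntegrableOn (fun t => Real.exp (-(p * t)) • (Ioo 0 T).indicator u t)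
      (Ioi 0) := fun p => by
    rw [hcut]
    exact ((integrable_indicator_iff measurableSet_Ioo).2
      (integrable_exp_smul_of_integrableOn_Ioo huint p)).integrableOn
  have hSint : ∀ {p : ℝ}, 0 < p → IntegrableOn (fun t => Real.exp (-(p * t)) • S t) (Ioi 0) :=
    integrableOn_exp_smul_solutionOp h hγ' hα0 hα1 hγ hγc hc' a
  have hzero := ae_eq_zero_of_laplace_decay (v := fun t => (Ioo 0 T).indicator u t - S t) (T := T)
    (K := K) (by simpa only [smul_sub, one_mul] using! (hint 1).sub (hSint one_pos)) fun p hp => by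
      have hp0 : 0 < p := by linarith
      simp_rw [smul_sub]
      rw [integral_sub (hint p) (hSint hp0), hcut, setIntegral_indicator measurableSet_Ioo,
        inter_eq_self_of_subset_right Ioo_subset_Ioi_self,
        laplace_solutionOp h hγ' hα0 hα1 hγ hγc hc hc' a hp0]
      exact hK p hp
  filter_upwards [hzero, ae_restrict_mem measurableSet_Ioo] with t ht htT
  rwa [indicator_of_mem htT, Pi.zero_apply, sub_eq_zero] at ht

end SolutionOp

end StrongSolutions

end TimeFractional

theorem corollary4p1 {X : Type*} [NormedAddCommGroup X] [NormedSpace ℂ X] [CompleteSpace X]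
    (A : X →ₗ.[ℂ] X) (hA : TimeFractional.ConditionA A)
    (α : ℝ) (hα0 : 0 < α) (hα1 : α < 1) :
    ∃ C : ℝ, 0 < C ∧
      ∀ (q : ℝ≥0∞) (μ : ℝ), 1 ≤ q → 1 - (q⁻¹).toReal / α < μ → μ < 1 →
      ∀ a ∈ TimeFractional.fracDomain A μ, ∀ u : ℝ → X,
        (∀ T : ℝ, 0 < T → TimeFractional.IsStrongSolution A α q T a u) →
        ∃ v : ℝ → X, ContinuousOn v (Ioi 0) ∧ u =ᵐ[volume.restrict (Ioi 0)] v ∧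
          ∀ t : ℝ, 0 < t → ‖v t‖ ≤ C * t ^ (-α) * ‖a‖ := by
  open TimeFractional in
  obtain ⟨γ, hγ, hsub, hbound⟩ := hA.sectorial
  have hγ0 : 0 < γ := by linarith [hγ.1, Real.pi_pos]
  -- For `|arg λ| ≤ γ` the points `λ ^ α` stay in the strictly smaller sector of angle `δ * γ`.
  obtain ⟨δ, hαδ, hδ1⟩ := exists_between hα1
  have hδ0 : 0 < δ := hα0.trans hαδ
  obtain ⟨C, hC0, hC⟩ := hbound ((1 - δ) * γ) ⟨mul_pos (sub_pos.2 hδ1) hγ0, by nlinarith⟩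
  rw [show γ - (1 - δ) * γ = δ * γ by ring] at hC
  have hδγ : δ * γ < γ := by nlinarith
  obtain ⟨M, hM0, h⟩ := exists_sectorBound hA.zero_mem
    (fun z hz => hsub ⟨hz.1, hz.2.trans hδγ⟩) hC hC0.le
  have hδγπ : δ * γ < Real.pi := hδγ.trans hγ.2
  have hγc : γ < min Real.pi (δ * γ / α) := lt_min hγ.2 <| by
    rw [lt_div_iff₀ hα0]
    nlinarith
  set κ := ∫ x : ℝ, Real.exp (α * x) * Real.exp (-(-Real.cos γ * Real.exp x))
  have hκ : 0 ≤ κ := integral_nonneg fun x => by positivity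
  refine ⟨M * κ + 1, by positivity, fun q μ hq _ _ a _ u hu => ⟨solutionOp A α γ a, ?_, ?_, ?_⟩⟩
  · exact continuousOn_sectorInverse hα0 hα1 hγ hγc
      (h.stripBound hδγπ hα0 (min_le_right _ _) a)
  · have hn : ∀ n : ℕ, ∀ᵐ t : ℝ, t ∈ Ioo 0 ((n : ℝ) + 1) → u t = solutionOp A α γ a t := fun n =>
      (ae_restrict_iff' measurableSet_Ioo).1 ((hu _ (by positivity)).ae_eq_solutionOp h hδγπ
        (mul_pos hδ0 hγ0) hα0 hα1 hγ hγc (min_le_left _ _) (min_le_right _ _) hq (by positivity))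
    refine (ae_restrict_iff' measurableSet_Ioi).2 ?_
    filter_upwards [ae_all_iff.2 hn] with t ht ht0
    obtain ⟨n, hnt⟩ := exists_nat_gt t
    exact ht n ⟨ht0, by linarith⟩
  · intro t ht
    have hS := norm_sectorInverse_le hα0 hα1 hγ hγc
      (h.stripBound hδγπ hα0 (min_le_right _ _) a) ht
    have htα : 0 ≤ t ^ (-α) * ‖a‖ := by positivity
    calc ‖solutionOp A α γ a t‖ ≤ M * ‖a‖ * t ^ (-α) * κ := hS
      _ = M * κ * (t ^ (-α) * ‖a‖) := by ring
      _ ≤ (M * κ + 1) * (t ^ (-α) * ‖a‖) := by gcongr; linarith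
      _ = _ := by ring
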